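/- Let $n\ge 1$ and let $\mathfrak g$ be the real vector space of complex $n\times n$ matrices. Write $\mathfrak g=\mathfrak l\oplus\mathfrak a$, where $\mathfrak a$ consists of the anti-Hermitian matrices and $\mathfrak l$ of the lower triangular matrices with real diagonal, and put $R(L+A)=L-A$ for $L\in\mathfrak l$, $A\in\mathfrak a$. Let $\langle X,Y\rangle=\operatorname{Im}\operatorname{tr}(XY)$, define $\nabla\phi|_B\in\mathfrak g$ by $\frac{d}{dt}\big|_{t=0}\phi(B+tC)=\langle\nabla\phi|_B,C\rangle$ for all $C\in\mathfrak g$, and let $$\{\phi,\psi\}|_B=\tfrac12\langle R(XB),YB\rangle-\tfrac12\langle R(BX),BY\rangle,\qquad X=\nabla\phi|_B,\ Y=\nabla\psi|_B .$$ The Hamiltonian vector field of a smooth real function $\phi$ on an open subset of $\mathfrak g$ is the vector field that differentiates every smooth $\psi$ to $\{\phi,\psi\}$. The symplectic leaf through $B\in\mathfrak g$ is the set of all points that can be reached from $B$ along finitely many pieces of integral curves of such Hamiltonian vector fields. Given $\alpha_0,\dots,\alpha_{n-2}\in\mathbb C$ with $|\alpha_k|<1$ and $\alpha_{n-1}$ with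 $|\alpha_{n-1}|=1$, let $\rho_k=\sqrt{1-|\alpha_k|^2}$, $\Xi_k=\begin{bmatrix}\bar\alpha_k&\rho_k\\ \rho_k&-\alpha_k\end{bmatrix}$ for $0\le k\le n-2$, $\Xi_{-1}=[1]$ and $\Xi_{n-1}=[\bar\alpha_{n-1}]$. The associated CMV matrix is the $n\times n$ matrix $\operatorname{diag}(\Xi_0,\Xi_2,\Xi_4,\dots)\operatorname{diag}(\Xi_{-1},\Xi_1,\Xi_3,\dots)$. A matrix $C\in\mathfrak g$ has CMV shape if, with rows and columns numbered from $1$, rows $2b+1$ and $2b+2$ vanish outside columns $2b,\dots,2b+3$ for every $b\ge0$, and the exposed entries, in the positions $(2,1)$, $(2j-1,2j+1)$ and $(2j+2,2j)$ with $j\ge1$ (as far as these lie in the matrix), are positive real numbers. Then the following hold. 1. The symplectic leaf through a CMV matrix $\mathcal C$ contains only CMV matrices, and all of them have determinant $\det\mathcal C$. 2. The determinant is a Casimir: $\{g\circ\det,\psi\}|_B=0$ for every $B\in\mathfrak g$, every $g:\mathbb C\to\mathbb R$ that is real differentiable at $\det B$ and every $\psi:\mathfrak g\to\mathbb R$ that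 is differentiable at $B$. 3. An integral curve of the Hamiltonian vector field of a smooth real function on an open subset of $\mathfrak g$ that is unitary at one time is unitary at all times. 4. Such an integral curve that is a CMV matrix at one time has CMV shape at all times; in particular its exposed entries remain positive. -/

import Mathlib

open scoped ContDiff

attribute [local instance] Matrix.normedAddCommGroup Matrix.normedSpace

namespace CMV

noncomputable section

/-- The algebra `𝔤` of complex `n × n` matrices. Its real normed space structure (entrywise sup
norm) only serves to speak of derivatives; all norms on it are equivalent. -/
abbrev Mat (n : ℕ) : Type := Matrix (Fin n) (Fin n) ℂ

/-! ### CMV matrices (rows and columns are numbered from `0`) -/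

/-- `α₀, …, α_{n-2}` lie in the open unit disk and `α_{n-1}` on the unit circle. -/
def IsVerblunsky {n : ℕ} (α : Fin n → ℂ) : Prop :=
  ∀ k : Fin n, ((k : ℕ) + 1 < n → ‖α k‖ < 1) ∧ ((k : ℕ) + 1 = n → ‖α k‖ = 1)

/-- `ρ = √(1 - |α|²)`. -/
def rho (a : ℂ) : ℝ := Real.sqrt (1 - ‖a‖ ^ 2)

/-- The block diagonal matrix whose blocks are the `Ξ_k` with `k ≡ p (mod 2)`, where
`Ξ_k = [[conj α_k, ρ_k], [ρ_k, -α_k]]` occupies the rows and columns `k, k + 1`. The block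
`Ξ_{n-1} = [conj α_{n-1}]` is cut down to the last row and column, and for `p = 1` the block
`Ξ_{-1} = [1]` occupies row and column `0`. -/
def cmvFactor {n : ℕ} (p : ℕ) (α : Fin n → ℂ) : Mat n :=
  Matrix.of fun i j =>
    if (i : ℕ) = j then
      if (i : ℕ) % 2 = p then (starRingEnd ℂ) (α i)
      else if (i : ℕ) = 0 then 1
      else -α ⟨(i : ℕ) - 1, lt_of_le_of_lt (Nat.sub_le _ _) i.isLt⟩
    else if (j : ℕ) = i + 1 ∧ (i : ℕ) % 2 = p then (rho (α i) : ℂ)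
    else if (i : ℕ) = j + 1 ∧ (j : ℕ) % 2 = p then (rho (α j) : ℂ)
    else 0

/-- The CMV matrix `𝓛𝓜`, with `𝓛 = diag(Ξ₀, Ξ₂, …)` and `𝓜 = diag(Ξ₋₁, Ξ₁, Ξ₃, …)`. -/
def cmvMatrix {n : ℕ} (α : Fin n → ℂ) : Mat n := cmvFactor 0 α * cmvFactor 1 α

/-- `C` is a CMV matrix. -/
def IsCMV {n : ℕ} (C : Mat n) : Prop :=
  ∃ α : Fin n → ℂ, IsVerblunsky α ∧ C = cmvMatrix α

/-- The exposed positions; numbered from `1` they are `(2,1)`, `(2j-1,2j+1)` and `(2j+2,2j)`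
with `j ≥ 1`. -/
def IsExposed {n : ℕ} (i j : Fin n) : Prop :=
  ((i : ℕ) = 1 ∧ (j : ℕ) = 0) ∨ ((i : ℕ) % 2 = 0 ∧ (j : ℕ) = i + 2) ∨
    ((j : ℕ) % 2 = 1 ∧ (i : ℕ) = j + 2)

/-- CMV shape: numbered from `0`, the rows `2b, 2b + 1` vanish outside the columns
`2b - 1, …, 2b + 2`, and the exposed entries are positive reals. -/
def HasCMVShape {n : ℕ} (C : Mat n) : Prop :=
  (∀ i j : Fin n, ¬ (2 * ((i : ℕ) / 2) ≤ (j : ℕ) + 1 ∧ (j : ℕ) ≤ 2 * ((i : ℕ) / 2) + 2) →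
      C i j = 0) ∧
    ∀ i j : Fin n, IsExposed i j → 0 < (C i j).re ∧ (C i j).im = 0

/-! ### The splitting `𝔤 = 𝔩 ⊕ 𝔞` -/

/-- `𝔞`: the anti-Hermitian matrices. -/
def antiHerm (n : ℕ) : Submodule ℝ (Mat n) where
  carrier := {A | A.conjTranspose = -A}
  add_mem' {A B} hA hB := by
    simp only [Set.mem_ofPred_eq] at *
    rw [Matrix.conjTranspose_add, hA, hB, neg_add]
  zero_mem' := by simp
  smul_mem' c A hA := by
    simp only [Set.mem_ofPred_eq] at *
    rw [Matrix.conjTranspose_smul, hA, smul_neg, star_trivial]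

/-- `𝔩`: the lower triangular matrices with real diagonal. -/
def lowerTri (n : ℕ) : Submodule ℝ (Mat n) where
  carrier := {L | (∀ i j, i < j → L i j = 0) ∧ ∀ i, (L i i).im = 0}
  add_mem' {A B} hA hB :=
    ⟨fun i j h => by simp [hA.1 i j h, hB.1 i j h], fun i => by simp [hA.2 i, hB.2 i]⟩
  zero_mem' := ⟨fun _ _ _ => rfl, fun _ => rfl⟩
  smul_mem' c A hA := ⟨fun i j h => by simp [hA.1 i j h], fun i => by simp [hA.2 i]⟩

/-- The projection onto `𝔞` along `𝔩`. -/
def piA {n : ℕ} (X : Mat n) : Mat n :=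
  Matrix.of fun i j =>
    if i < j then X i j
    else if j < i then -(starRingEnd ℂ) (X j i)
    else Complex.I * ((X i i).im : ℂ)

/-- The projection onto `𝔩` along `𝔞`. -/
def piL {n : ℕ} (X : Mat n) : Mat n := X - piA X

theorem piA_mem {n : ℕ} (X : Mat n) : piA X ∈ antiHerm n := by
  change (piA X).conjTranspose = -piA X
  ext i j
  rcases lt_trichotomy i j with h | h | h
  · simp [piA, h, h.not_gt]
  · subst h; simp [piA]
  · simp [piA, h, h.not_gt]

theorem piL_mem {n : ℕ} (X : Mat n) : piL X ∈ lowerTri n := by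
  refine ⟨fun i j h => ?_, fun i => ?_⟩
  · simp [piL, piA, h]
  · simp [piL, piA]

theorem piA_add {n : ℕ} {L A : Mat n} (hL : L ∈ lowerTri n) (hA : A ∈ antiHerm n) :
    piA (L + A) = A := by
  have hA' : ∀ i j, (starRingEnd ℂ) (A j i) = -A i j := fun i j => by
    have := congrFun (congrFun (show A.conjTranspose = -A from hA) i) j
    simpa using this
  ext i j
  rcases lt_trichotomy i j with h | h | h
  · simp [piA, h, hL.1 i j h]
  · subst h
    have h1 := congrArg Complex.re (hA' i i)
    simp only [Complex.conj_re, Complex.neg_re] at h1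
    apply Complex.ext
    · simp [piA]; linarith
    · simp [piA, hL.2 i]
  · simp [piA, h, h.not_gt, hL.1 j i h, hA' i j]

theorem piL_add {n : ℕ} {L A : Mat n} (hL : L ∈ lowerTri n) (hA : A ∈ antiHerm n) :
    piL (L + A) = L := by
  rw [piL, piA_add hL hA, add_sub_cancel_right]

/-- `R(L + A) = L - A` for `L ∈ 𝔩` and `A ∈ 𝔞`. -/
def R {n : ℕ} (X : Mat n) : Mat n := piL X - piA X

/-! ### The Poisson bracket, Hamiltonian vectors, symplectic leaves -/

/-- The pairing `⟨X, Y⟩ = Im tr (XY)`. -/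
def pairing {n : ℕ} (X Y : Mat n) : ℝ := ((X * Y).trace).im

/-- The gradient: `[∇φ]_{k,l} = ∂φ/∂v_{l,k} + i ∂φ/∂u_{l,k}`, where `b = u + i v` are the matrix
entries. -/
def grad {n : ℕ} (φ : Mat n → ℝ) (B : Mat n) : Mat n :=
  Matrix.of fun k l =>
    (fderiv ℝ φ B (Matrix.single l k Complex.I) : ℂ) +
      Complex.I * (fderiv ℝ φ B (Matrix.single l k 1) : ℂ)

/-- The gradient represents the differential through the pairing. -/
theorem pairing_grad {n : ℕ} (φ : Mat n → ℝ) (B C : Mat n) :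
    pairing (grad φ B) C = fderiv ℝ φ B C := by
  have hC : C = ∑ l, ∑ k, ((C l k).re • Matrix.single l k (1 : ℂ)
      + (C l k).im • Matrix.single l k Complex.I) := by
    conv_lhs => rw [Matrix.matrix_eq_sum_single C]
    refine Finset.sum_congr rfl fun l _ => Finset.sum_congr rfl fun k _ => ?_
    rw [Matrix.smul_single, Matrix.smul_single, ← Matrix.single_add]
    congr 1
    apply Complex.ext <;> simp
  conv_rhs => rw [hC]
  simp only [map_sum, map_add, map_smul, smul_eq_mul]
  simp only [pairing, Matrix.trace, Matrix.diag, Matrix.mul_apply, Complex.im_sum]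
  rw [Finset.sum_comm]
  refine Finset.sum_congr rfl fun l _ => Finset.sum_congr rfl fun k _ => ?_
  simp [grad, Complex.mul_im]
  ring

/-- The bracket `{φ, ψ}|_B = ½⟨R(XB), YB⟩ - ½⟨R(BX), BY⟩` with `X = ∇φ|_B`, `Y = ∇ψ|_B`. -/
def poissonBracket {n : ℕ} (φ ψ : Mat n → ℝ) (B : Mat n) : ℝ :=
  1 / 2 * pairing (R (grad φ B * B)) (grad ψ B * B)
    - 1 / 2 * pairing (R (B * grad φ B)) (B * grad ψ B)

/-- `V` is the value at `B` of the Hamiltonian vector field of `φ`: its derivative of any smooth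
function `ψ` is `{φ, ψ}`. -/
def IsHamiltonianVector {n : ℕ} (φ : Mat n → ℝ) (B V : Mat n) : Prop :=
  ∀ ψ : Mat n → ℝ, ContDiff ℝ ∞ ψ → fderiv ℝ ψ B V = poissonBracket φ ψ B

/-- `γ`, restricted to the interval `s`, is an integral curve of the Hamiltonian vector field of
a smooth function `φ` that is defined on the open set `U`. -/
structure IsHamiltonianCurve {n : ℕ} (U : Set (Mat n)) (φ : Mat n → ℝ) (s : Set ℝ)
    (γ : ℝ → Mat n) : Prop where
  isOpen : IsOpen U
  smooth : ContDiffOn ℝ ∞ φ U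
  ordConnected : s.OrdConnected
  mem : ∀ t ∈ s, γ t ∈ U
  deriv : ∀ t ∈ s, ∃ V, IsHamiltonianVector φ (γ t) V ∧ HasDerivWithinAt γ V s t

/-- `B` and `B'` are the end points of a Hamiltonian curve. -/
def HamiltonianStep {n : ℕ} (B B' : Mat n) : Prop :=
  ∃ (U : Set (Mat n)) (φ : Mat n → ℝ) (T : ℝ) (γ : ℝ → Mat n),
    0 ≤ T ∧ IsHamiltonianCurve U φ (Set.Icc 0 T) γ ∧ γ 0 = B ∧ γ T = B'

/-- The symplectic leaf through `B`: all points that can be reached from `B` along finitely many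
pieces of integral curves of (locally defined) Hamiltonian vector fields. -/
def symplecticLeaf {n : ℕ} (B : Mat n) : Set (Mat n) :=
  {B' | Relation.ReflTransGen HamiltonianStep B B'}

end

end CMV

namespace CMV

open Matrix

/-! With `X` the gradient at `B`, nondegeneracy of the pairing turns the bracket into the vector
field `½ (B R(XB) - R(BX) B)`. Since `B(XB) = (BX)B`, this equals both `piA(BX) B - B piA(XB)` and
`B piL(XB) - piL(BX) B`, and each form has its own consequences.

The anti-Hermitian form makes `γ*γ - 1` solve a homogeneous linear equation, so unitarity persists
(`IsHamiltonianCurve.mem_unitaryGroup`). It also makes the determinant constant, because `tr(BX) =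
tr(XB)` (`IsHamiltonianCurve.det_eq`).

The triangular form makes zeros spread over an upper right region persist, and an entry at the
corner of such a region solves a scalar linear equation with real coefficient, hence stays positive
(`eq_zero_of_lowerTri_deriv`, `pos_of_lowerTri_deriv`). On unitary matrices `γ*` is the inverse of
`γ` and obeys an equation of the same form, which controls the lower left zeros and exposed entries.
Thus CMV shape persists (`IsHamiltonianCurve.hasCMVShape`).

That the leaf contains only CMV matrices then follows from a purely algebraic fact: unitary matrices
of CMV shape are CMV matrices (`HasCMVShape.isCMV`). The Verblunsky coefficients are peeled off one
at a time by rotating the first column to the first unit vector (`HasCMVShape.exists_rotation`).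

For the Casimir property, the gradient `X` of a function of the determinant makes `XB` and `BX` the
same scalar matrix, so the two halves of the bracket cancel. -/

/-! ### Factorization of unitary matrices of CMV shape -/

/-- The block diagonal matrix `1 ⊕ X`. -/
def oneSum {n : ℕ} (X : Mat n) : Mat (n + 1) :=
  Matrix.of (Fin.cons (Fin.cons 1 fun _ => 0) fun i => Fin.cons 0 (X i))

@[simp] theorem oneSum_zero_zero {n : ℕ} (X : Mat n) : oneSum X 0 0 = 1 := rfl

@[simp] theorem oneSum_zero_succ {n : ℕ} (X : Mat n) (j : Fin n) : oneSum X 0 j.succ = 0 := rfl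

@[simp] theorem oneSum_succ_zero {n : ℕ} (X : Mat n) (i : Fin n) : oneSum X i.succ 0 = 0 := rfl

@[simp] theorem oneSum_succ_succ {n : ℕ} (X : Mat n) (i j : Fin n) :
    oneSum X i.succ j.succ = X i j := rfl

theorem oneSum_injective {n : ℕ} : Function.Injective (oneSum (n := n)) := fun X Y h => by
  ext i j
  simpa using congrFun (congrFun h i.succ) j.succ

theorem oneSum_mul {n : ℕ} (X Y : Mat n) : oneSum (X * Y) = oneSum X * oneSum Y := by
  ext i j
  refine Fin.cases ?_ (fun i => ?_) i <;> refine Fin.cases ?_ (fun j => ?_) j <;>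
    simp [Matrix.mul_apply, Fin.sum_univ_succ]

theorem oneSum_one {n : ℕ} : oneSum (1 : Mat n) = 1 := by
  ext i j
  refine Fin.cases ?_ (fun i => ?_) i <;> refine Fin.cases ?_ (fun j => ?_) j <;>
    simp [Matrix.one_apply, (Fin.succ_ne_zero _).symm]

theorem star_oneSum {n : ℕ} (X : Mat n) : star (oneSum X) = oneSum (star X) := by
  ext i j
  refine Fin.cases ?_ (fun i => ?_) i <;> refine Fin.cases ?_ (fun j => ?_) j <;>
    simp [Matrix.star_apply]

theorem oneSum_mem_unitaryGroup {n : ℕ} {X : Mat n} :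
    oneSum X ∈ unitaryGroup (Fin (n + 1)) ℂ ↔ X ∈ unitaryGroup (Fin n) ℂ := by
  rw [mem_unitaryGroup_iff, mem_unitaryGroup_iff, star_oneSum, ← oneSum_mul, ← oneSum_one,
    oneSum_injective.eq_iff]

@[simp] theorem oneSum_one_zero {n : ℕ} (X : Mat (n + 1)) : oneSum X 1 0 = 0 := rfl

/-- The block diagonal matrix `Ξ ⊕ 1`, with `Ξ = [[conj a, ρ], [ρ, -a]]` in the first two rows and
columns. -/
noncomputable def rotation (n : ℕ) (a : ℂ) : Mat (n + 2) :=
  Matrix.of (Fin.cons (Fin.cons ((starRingEnd ℂ) a) (Fin.cons (rho a : ℂ) fun _ => 0))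
    (Fin.cons (Fin.cons (rho a : ℂ) (Fin.cons (-a) fun _ => 0))
      fun i => Fin.cons 0 (Fin.cons 0 fun j => if i = j then 1 else 0)))

theorem rotation_mul_zero {n : ℕ} (a : ℂ) (X : Mat (n + 2)) (j : Fin (n + 2)) :
    (rotation n a * X) 0 j = (starRingEnd ℂ) a * X 0 j + rho a * X 1 j := by
  simp [Matrix.mul_apply, Fin.sum_univ_succ, rotation]

theorem rotation_mul_one {n : ℕ} (a : ℂ) (X : Mat (n + 2)) (j : Fin (n + 2)) :
    (rotation n a * X) 1 j = rho a * X 0 j - a * X 1 j := by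
  have : (1 : Fin (n + 2)) = Fin.succ 0 := rfl
  simp only [this]
  simp [Matrix.mul_apply, Fin.sum_univ_succ, rotation]
  ring

theorem rotation_mul_succ_succ {n : ℕ} (a : ℂ) (X : Mat (n + 2)) (i : Fin n) (j : Fin (n + 2)) :
    (rotation n a * X) i.succ.succ j = X i.succ.succ j := by
  simp [Matrix.mul_apply, Fin.sum_univ_succ, rotation]

theorem star_rotation (n : ℕ) (a : ℂ) :
    star (rotation n a) = rotation n ((starRingEnd ℂ) a) := by
  ext i j
  refine Fin.cases ?_ (Fin.cases ?_ fun i => ?_) i <;>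
    refine Fin.cases ?_ (Fin.cases ?_ fun j => ?_) j <;>
    simp [Matrix.star_apply, rotation, rho, eq_comm]

theorem rho_sq {a : ℂ} (ha : ‖a‖ ≤ 1) : (rho a : ℂ) * rho a = 1 - a * (starRingEnd ℂ) a := by
  rw [Complex.mul_conj, Complex.normSq_eq_norm_sq, ← Complex.ofReal_mul, rho,
    Real.mul_self_sqrt (by nlinarith [norm_nonneg a])]
  push_cast
  ring

theorem rho_pos {a : ℂ} (ha : ‖a‖ < 1) : 0 < rho a :=
  Real.sqrt_pos.2 (by nlinarith [norm_nonneg a])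

theorem rho_conj (a : ℂ) : rho ((starRingEnd ℂ) a) = rho a := by simp [rho]

theorem rotation_mem_unitaryGroup {n : ℕ} {a : ℂ} (ha : ‖a‖ ≤ 1) :
    rotation n a ∈ unitaryGroup (Fin (n + 2)) ℂ := by
  have h := rho_sq ha
  rw [mem_unitaryGroup_iff, star_rotation]
  ext i j
  refine Fin.cases ?_ (Fin.cases ?_ fun i => ?_) i
  · rw [rotation_mul_zero]
    refine Fin.cases ?_ (Fin.cases ?_ fun j => ?_) j
    · simp [rotation, rho_conj, h, mul_comm]
    · simp [rotation, rho_conj, mul_comm, Matrix.one_apply]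
    · simp [rotation, rho_conj, (Fin.succ_ne_zero _).symm]
  · rw [Fin.succ_zero_eq_one, rotation_mul_one]
    refine Fin.cases ?_ (Fin.cases ?_ fun j => ?_) j
    · simp [rotation, rho_conj, mul_comm]
    · rw [Fin.succ_zero_eq_one, one_apply_eq]
      simp [rotation, rho_conj, h]
    · have : (1 : Fin (n + 2)) ≠ j.succ.succ := by simp [Fin.ext_iff]
      simp [rotation, this]
  · rw [rotation_mul_succ_succ]
    refine Fin.cases ?_ (Fin.cases ?_ fun j => ?_) j
    · simp [rotation]
    · have : i.succ.succ ≠ (1 : Fin (n + 2)) := by simp [Fin.ext_iff]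
      simp [rotation, Matrix.one_apply, this]
    · simp [rotation, Matrix.one_apply]

/-! ### Recursion and unitarity of the two CMV factors. -/

theorem transpose_cmvFactor {n : ℕ} (p : ℕ) (α : Fin n → ℂ) :
    (cmvFactor p α)ᵀ = cmvFactor p α := by
  ext i j
  by_cases h : i = j
  · subst h; rfl
  · have h1 : (i : ℕ) ≠ j := fun h' => h (Fin.ext h')
    simp only [cmvFactor, transpose_apply, of_apply, if_neg h1, if_neg h1.symm]
    split_ifs with h2 h3 <;> first | rfl | omega

/-- Dropping the first coefficient shifts all indices by one and so exchanges the two parities; the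
split-off `1` is the block `Ξ₋₁`. -/
theorem cmvFactor_one {n : ℕ} (α : Fin (n + 1) → ℂ) :
    cmvFactor 1 α = oneSum (cmvFactor 0 (Fin.tail α)) := by
  ext i j
  refine Fin.cases ?_ (fun i => ?_) i <;> refine Fin.cases ?_ (fun j => ?_) j
  · simp [cmvFactor]
  · simp [cmvFactor]
  · simp [cmvFactor]
  · simp only [oneSum_succ_succ, cmvFactor, of_apply, Fin.val_succ, Fin.tail]
    have e1 : ∀ k : ℕ, (k + 1) % 2 = 1 ↔ k % 2 = 0 := fun k => by omega
    simp only [e1, add_left_inj]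
    split_ifs <;> first | rfl | omega | contradiction | skip
    congr 2
    apply Fin.ext
    simp
    omega

/-- The odd factor of the tail itself begins with a `1`, so `oneSum` of it is the identity on the
first two coordinates, which leaves room for `Ξ₀`. Size at least two is needed for `Ξ₀` to be a full
block. -/
theorem cmvFactor_zero {n : ℕ} (α : Fin (n + 2) → ℂ) :
    cmvFactor 0 α = rotation n (α 0) * oneSum (cmvFactor 1 (Fin.tail α)) := by
  ext i j
  refine Fin.cases ?_ (Fin.cases ?_ fun i => ?_) i
  · rw [rotation_mul_zero, ← Fin.succ_zero_eq_one]
    refine Fin.cases ?_ (fun j => ?_) j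
    · simp [cmvFactor]
    · rw [oneSum_succ_succ, oneSum_zero_succ]
      refine Fin.cases ?_ (fun j => ?_) j <;> simp [cmvFactor]
  · rw [Fin.succ_zero_eq_one, rotation_mul_one, ← Fin.succ_zero_eq_one]
    refine Fin.cases ?_ (fun j => ?_) j
    · simp [cmvFactor]
    · rw [oneSum_succ_succ, oneSum_zero_succ]
      refine Fin.cases ?_ (fun j => ?_) j <;> simp [cmvFactor]
  · rw [rotation_mul_succ_succ]
    refine Fin.cases ?_ (fun j => ?_) j
    · simp [cmvFactor]
    · rw [oneSum_succ_succ]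
      simp only [cmvFactor, of_apply, Fin.val_succ, Fin.tail]
      have e1 : ∀ k : ℕ, (k + 1) % 2 = 1 ↔ k % 2 = 0 := fun k => by omega
      have e2 : ∀ k : ℕ, (k + 1 + 1) % 2 = 0 ↔ k % 2 = 0 := fun k => by omega
      have e3 : (j : ℕ) % 2 = 1 ↔ ((j : ℕ) + 1) % 2 = 0 := by omega
      simp only [e1, e2, e3, add_left_inj]
      split_ifs <;> rfl

theorem IsVerblunsky.norm_le_one {n : ℕ} {α : Fin n → ℂ} (h : IsVerblunsky α) (k : Fin n) :
    ‖α k‖ ≤ 1 := by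
  rcases (Nat.succ_le_of_lt k.isLt).lt_or_eq with h1 | h1
  · exact ((h k).1 h1).le
  · exact ((h k).2 h1).le

theorem IsVerblunsky.tail {n : ℕ} {α : Fin (n + 1) → ℂ} (h : IsVerblunsky α) :
    IsVerblunsky (Fin.tail α) := fun k =>
  ⟨fun hk => (h k.succ).1 (by simpa using hk), fun hk => (h k.succ).2 (by simpa using hk)⟩

theorem cmvFactor_mem_unitaryGroup {n : ℕ} {α : Fin n → ℂ} (h : IsVerblunsky α) :
    cmvFactor 0 α ∈ unitaryGroup (Fin n) ℂ ∧ cmvFactor 1 α ∈ unitaryGroup (Fin n) ℂ := by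
  induction n with
  | zero => exact ⟨by rw [mem_unitaryGroup_iff]; ext i; exact i.elim0,
      by rw [mem_unitaryGroup_iff]; ext i; exact i.elim0⟩
  | succ n ih =>
    refine ⟨?_, ?_⟩
    · cases n with
      | zero =>
        rw [mem_unitaryGroup_iff]
        ext i j
        fin_cases i
        fin_cases j
        simp [Matrix.mul_apply, cmvFactor, mul_comm _ (α 0), Complex.mul_conj,
          Complex.normSq_eq_norm_sq, (h 0).2 rfl]
      | succ n =>
        rw [cmvFactor_zero]
        exact mul_mem (rotation_mem_unitaryGroup (h.norm_le_one 0))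
          (oneSum_mem_unitaryGroup.2 (ih h.tail).2)
    · rw [cmvFactor_one]
      exact oneSum_mem_unitaryGroup.2 (ih h.tail).1

theorem IsCMV.mem_unitaryGroup {n : ℕ} {C : Mat n} (h : IsCMV C) :
    C ∈ unitaryGroup (Fin n) ℂ := by
  obtain ⟨α, hα, rfl⟩ := h
  exact mul_mem (cmvFactor_mem_unitaryGroup hα).1 (cmvFactor_mem_unitaryGroup hα).2

/-! ### CMV matrices have CMV shape. -/

theorem cmvFactor_zero_eq_zero {n : ℕ} (α : Fin n → ℂ) {i j : Fin n}
    (h : (i : ℕ) / 2 ≠ j / 2) : cmvFactor 0 α i j = 0 := by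
  simp only [cmvFactor, of_apply]
  split_ifs <;> first | rfl | omega

theorem cmvFactor_one_eq_zero {n : ℕ} (α : Fin n → ℂ) {i j : Fin n}
    (h : ((i : ℕ) + 1) / 2 ≠ (j + 1) / 2) : cmvFactor 1 α i j = 0 := by
  simp only [cmvFactor, of_apply]
  split_ifs <;> first | rfl | omega

theorem IsCMV.hasCMVShape {n : ℕ} {C : Mat n} (h : IsCMV C) : HasCMVShape C := by
  obtain ⟨α, hα, rfl⟩ := h
  refine ⟨fun i j hij => ?_, fun i j hij => ?_⟩
  · rw [cmvMatrix, Matrix.mul_apply]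
    refine Finset.sum_eq_zero fun k _ => ?_
    by_cases h1 : (i : ℕ) / 2 = k / 2
    · rw [cmvFactor_one_eq_zero, mul_zero]
      omega
    · rw [cmvFactor_zero_eq_zero α h1, zero_mul]
  -- At an exposed position, the block of the first factor containing `i` and the block of the
  -- second containing `j` share exactly one index, so the entry is a single product: `ρ₀ · 1` or a
  -- product of two consecutive `ρ`s.
  · have key : ∀ k : Fin n, (∀ l : Fin n, (i : ℕ) / 2 = l / 2 → ((l : ℕ) + 1) / 2 = (j + 1) / 2 →
        l = k) → cmvMatrix α i j = cmvFactor 0 α i k * cmvFactor 1 α k j := fun k hk => by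
      rw [cmvMatrix, Matrix.mul_apply]
      refine Finset.sum_eq_single k (fun l _ hl => ?_) (by simp)
      by_cases h1 : (i : ℕ) / 2 = l / 2
      · by_cases h2 : ((l : ℕ) + 1) / 2 = (j + 1) / 2
        · exact absurd (hk l h1 h2) hl
        · rw [cmvFactor_one_eq_zero α h2, mul_zero]
      · rw [cmvFactor_zero_eq_zero α h1, zero_mul]
    have pos : ∀ k : Fin n, (k : ℕ) + 1 < n → 0 < rho (α k) := fun k hk => rho_pos ((hα k).1 hk)
    rcases hij with ⟨hi, hj⟩ | ⟨hi, hj⟩ | ⟨hi, hj⟩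
    · rw [key j fun l h1 h2 => Fin.ext (by omega)]
      have e1 : cmvFactor 0 α i j = rho (α j) := by
        simp [cmvFactor, hi, hj]
      have e2 : cmvFactor 1 α j j = 1 := by simp [cmvFactor, hj]
      rw [e1, e2]
      simpa using pos j (by omega)
    · rw [key ⟨i + 1, by omega⟩ fun l h1 h2 => Fin.ext (by simp; omega)]
      have e1 : cmvFactor 0 α i ⟨i + 1, by omega⟩ = rho (α i) := by
        simp [cmvFactor, hi]
      have e2 : cmvFactor 1 α ⟨i + 1, by omega⟩ j = rho (α ⟨i + 1, by omega⟩) := by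
        simp only [cmvFactor, of_apply]
        rw [if_neg (by omega), if_pos (by omega)]
      rw [e1, e2, ← Complex.ofReal_mul]
      exact ⟨by simpa using mul_pos (pos _ (by omega)) (pos _ (by simp; omega)), by simp⟩
    · rw [key ⟨j + 1, by omega⟩ fun l h1 h2 => Fin.ext (by simp; omega)]
      have e1 : cmvFactor 0 α i ⟨j + 1, by omega⟩ = rho (α ⟨j + 1, by omega⟩) := by
        simp only [cmvFactor, of_apply]
        rw [if_neg (by omega), if_neg (by omega), if_pos (by omega)]
      have e2 : cmvFactor 1 α ⟨j + 1, by omega⟩ j = rho (α j) := by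
        have h : (j : ℕ) ≠ j + 1 + 1 := by omega
        simp [cmvFactor, hi, h]
      rw [e1, e2, ← Complex.ofReal_mul]
      exact ⟨by simpa using mul_pos (pos _ (by simp; omega)) (pos _ (by omega)), by simp⟩

/-! ### Peeling off Verblunsky coefficients. -/

/-- A unitary matrix whose first column is the first unit vector splits off a block `1`. -/
theorem exists_eq_oneSum {n : ℕ} {D : Mat (n + 1)} (hD : D ∈ unitaryGroup (Fin (n + 1)) ℂ)
    (h0 : D 0 0 = 1) (h1 : ∀ i : Fin n, D i.succ 0 = 0) :
    D = oneSum (D.submatrix Fin.succ Fin.succ) := by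
  -- The other columns are orthogonal to the first one.
  have h2 : ∀ j : Fin n, D 0 j.succ = 0 := fun j => by
    have h := congrFun (congrFun (mem_unitaryGroup_iff'.1 hD) 0) j.succ
    simpa [Matrix.mul_apply, Fin.sum_univ_succ, Matrix.star_apply, h0, h1, Matrix.one_apply,
      (Fin.succ_ne_zero _).symm] using h
  ext i j
  refine Fin.cases ?_ (fun i => ?_) i <;> refine Fin.cases ?_ (fun j => ?_) j <;>
    simp [h0, h1, h2]

theorem transpose_mem_unitaryGroup {n : ℕ} {X : Mat n} (h : X ∈ unitaryGroup (Fin n) ℂ) :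
    Xᵀ ∈ unitaryGroup (Fin n) ℂ := by
  rw [mem_unitaryGroup_iff] at *
  have h' := congrArg Matrix.transpose (mul_eq_one_comm.1 h)
  rw [Matrix.transpose_mul, Matrix.transpose_one] at h'
  exact h'

/-- One step of the factorization: a unitary matrix of CMV shape is `Ξ₀ ⊕ 1` times `1 ⊕ Xᵀ`, where
`X` has CMV shape as well. -/
theorem HasCMVShape.exists_rotation {n : ℕ} {C : Mat (n + 2)} (hC : HasCMVShape C)
    (hU : C ∈ unitaryGroup (Fin (n + 2)) ℂ) :
    ∃ (a : ℂ) (X : Mat (n + 1)), ‖a‖ < 1 ∧ X ∈ unitaryGroup (Fin (n + 1)) ℂ ∧ HasCMVShape X ∧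
      C = rotation n a * oneSum Xᵀ := by
  obtain ⟨hz, hp⟩ := hC
  have h10 := hp 1 0 (Or.inl ⟨rfl, rfl⟩)
  have hcol : ∀ i : Fin n, C i.succ.succ 0 = 0 := fun i => hz _ _ (by simp; omega)
  -- The first column is a unit vector with only two possibly nonzero entries, the second of them
  -- positive; hence it is `(conj a, ρ, 0, …)` for some `a` in the open disk.
  have hnorm : ‖C 0 0‖ ^ 2 + (C 1 0).re ^ 2 = 1 := by
    have h := congrFun (congrFun (mem_unitaryGroup_iff'.1 hU) 0) 0
    have h' := congrArg Complex.re h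
    have e : (C 1 0) = ((C 1 0).re : ℂ) := by apply Complex.ext <;> simp [h10.2]
    simp only [Matrix.mul_apply, Fin.sum_univ_succ, Matrix.star_apply, hcol] at h'
    simp [h10.2] at h'
    rw [← Complex.normSq_eq_norm_sq, Complex.normSq_apply]
    nlinarith
  set a : ℂ := (starRingEnd ℂ) (C 0 0) with ha
  have hna : ‖a‖ = ‖C 0 0‖ := by simp [ha]
  have hlt : ‖a‖ < 1 := by
    rw [hna]
    nlinarith [norm_nonneg (C 0 0), h10.1]
  have hrho : C 1 0 = (rho a : ℂ) := by
    have : rho a = (C 1 0).re := by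
      rw [rho, hna, ← hnorm, add_sub_cancel_left, Real.sqrt_sq h10.1.le]
    rw [this]
    apply Complex.ext <;> simp [h10.2]
  have hsq := rho_sq hlt.le
  have hG := rotation_mem_unitaryGroup (n := n) hlt.le
  set D : Mat (n + 2) := star (rotation n a) * C with hDdef
  have hCD : C = rotation n a * D := by
    rw [hDdef, ← mul_assoc, mem_unitaryGroup_iff.1 hG, one_mul]
  have hDU : D ∈ unitaryGroup (Fin (n + 2)) ℂ := mul_mem (Unitary.star_mem hG) hU
  have hC00 : C 0 0 = (starRingEnd ℂ) a := by simp [ha]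
  have hD0 : ∀ j, D 0 j = a * C 0 j + rho a * C 1 j := fun j => by
    rw [hDdef, star_rotation, rotation_mul_zero, rho_conj]; simp
  have hD1 : ∀ j, D 1 j = rho a * C 0 j - (starRingEnd ℂ) a * C 1 j := fun j => by
    rw [hDdef, star_rotation, rotation_mul_one, rho_conj]
  have hD2 : ∀ (i : Fin n) j, D i.succ.succ j = C i.succ.succ j := fun i j => by
    rw [hDdef, star_rotation, rotation_mul_succ_succ]
  have hsplit := exists_eq_oneSum hDU (by rw [hD0, hC00, hrho, hsq]; ring) (by
    refine Fin.cases ?_ fun i => ?_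
    · rw [Fin.succ_zero_eq_one, hD1, hC00, hrho]; ring
    · rw [hD2, hcol])
  -- Deleting the first row and column shifts the staircase of zeros by one step, and the transpose
  -- restores the original parity pattern.
  refine ⟨a, (D.submatrix Fin.succ Fin.succ)ᵀ, hlt, ?_, ⟨fun i j hij => ?_, fun i j hij => ?_⟩, ?_⟩
  · rw [hsplit] at hDU
    exact transpose_mem_unitaryGroup (oneSum_mem_unitaryGroup.1 hDU)
  · simp only [transpose_apply, submatrix_apply]
    revert hij
    refine Fin.cases (fun hij => ?_) (fun j hij => ?_) j
    · rw [Fin.succ_zero_eq_one, hD1, hz 0 _ (by simp at hij ⊢; omega),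
        hz 1 _ (by simp at hij ⊢; omega)]
      ring
    · rw [hD2, hz _ _ (by simp at hij ⊢; omega)]
  · simp only [transpose_apply, submatrix_apply]
    revert hij
    refine Fin.cases (fun hij => ?_) (fun j hij => ?_) j
    · have hi : (i : ℕ) = 1 := by
        rcases hij with ⟨h, -⟩ | ⟨-, h⟩ | ⟨h, -⟩
        · exact h
        · simp at h
        · simp at h
      have h02 := hp 0 i.succ (Or.inr (Or.inl ⟨rfl, by simp [hi]⟩))
      have hrow : D 0 i.succ = 0 := by rw [hsplit, oneSum_zero_succ]
      have hr := rho_pos hlt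
      -- The only exposed entry of the remainder that the rotation alters. Solving `a C₀ + ρ C₁ = 0`
      -- for it shows that it is `C₀ / ρ`, which is positive.
      have hmul : (rho a : ℂ) * D 1 i.succ = C 0 i.succ := by
        rw [hD1]
        rw [hD0] at hrow
        linear_combination (C 0 i.succ) * hsq - (starRingEnd ℂ) a * hrow
      have hre := congrArg Complex.re hmul
      have him := congrArg Complex.im hmul
      rw [Complex.re_ofReal_mul] at hre
      rw [Complex.im_ofReal_mul, h02.2] at him
      refine ⟨?_, (mul_eq_zero.1 him).resolve_left hr.ne'⟩
      exact pos_of_mul_pos_right (hre ▸ h02.1) hr.le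
    · rw [hD2]
      refine hp _ _ ?_
      rcases hij with h | h | h
      · simp at h
      · right; right; simp at h ⊢; omega
      · right; left; simp at h ⊢; omega
  · rw [transpose_transpose, ← hsplit]
    exact hCD

/-- By induction the remainder is a product of two symmetric factors, so its transpose is the
product in reverse order. The rotation is then absorbed by the odd factor, which becomes the new
even one, while the even factor becomes the new odd one. -/
theorem HasCMVShape.isCMV_succ {n : ℕ} {C : Mat (n + 1)} (hC : HasCMVShape C)
    (hU : C ∈ unitaryGroup (Fin (n + 1)) ℂ) : IsCMV C := by
  induction n with
  | zero =>
    refine ⟨fun _ => (starRingEnd ℂ) (C 0 0), fun k => ⟨by omega, fun _ => ?_⟩, ?_⟩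
    · have h := congrFun (congrFun (mem_unitaryGroup_iff.1 hU) 0) 0
      simp only [Matrix.mul_apply, Fin.sum_univ_succ, Matrix.star_apply, Finset.univ_eq_empty,
        Finset.sum_empty, add_zero, Complex.star_def, Complex.mul_conj, Matrix.one_apply_eq] at h
      rw [Complex.norm_conj]
      have h' : Complex.normSq (C 0 0) = 1 := by exact_mod_cast h
      rw [Complex.normSq_eq_norm_sq] at h'
      nlinarith [norm_nonneg (C 0 0)]
    · ext i j
      fin_cases i
      fin_cases j
      simp [cmvMatrix, Matrix.mul_apply, cmvFactor]
  | succ n ih =>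
    obtain ⟨a, X, ha, hXU, hX, rfl⟩ := hC.exists_rotation hU
    obtain ⟨α, hα, rfl⟩ := ih hX hXU
    refine ⟨Fin.cons a α, fun k => ?_, ?_⟩
    · refine Fin.cases ⟨fun _ => ha, fun h => ?_⟩ (fun k => ⟨fun h => ?_, fun h => ?_⟩) k
      · simp at h
      · exact (hα k).1 (by simpa using h)
      · exact (hα k).2 (by simpa using h)
    · rw [cmvMatrix, cmvMatrix, Matrix.transpose_mul, transpose_cmvFactor, transpose_cmvFactor,
        oneSum_mul, cmvFactor_zero, cmvFactor_one (Fin.cons a α), Fin.tail_cons, Fin.cons_zero, mul_assoc]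

/-- Unitary matrices of CMV shape are CMV matrices. -/
theorem HasCMVShape.isCMV {n : ℕ} (hn : 1 ≤ n) {C : Mat n} (hC : HasCMVShape C)
    (hU : C ∈ unitaryGroup (Fin n) ℂ) : IsCMV C := by
  obtain ⟨m, rfl⟩ := Nat.exists_eq_add_of_le' hn
  exact hC.isCMV_succ hU

end CMV
namespace CMV

open Matrix Set

/-! ### Linear differential inequalities on an interval -/

/-- The coefficient `K` is bounded on the compact interval `[a, b]`, so Grönwall's inequality
applies. -/
theorem eq_zero_of_norm_deriv_le_of_le {E : Type*} [NormedAddCommGroup E] [NormedSpace ℝ E]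
    {s : Set ℝ} (hs : s.OrdConnected) {y y' : ℝ → E} {K : ℝ → ℝ} (hK : ContinuousOn K s)
    (hy : ∀ t ∈ s, HasDerivWithinAt y (y' t) s t) (hb : ∀ t ∈ s, ‖y' t‖ ≤ K t * ‖y t‖)
    {a b : ℝ} (ha : a ∈ s) (hbs : b ∈ s) (hab : a ≤ b) (h0 : y a = 0) : y b = 0 := by
  have hsub : Icc a b ⊆ s := hs.out ha hbs
  obtain ⟨M, hM⟩ := isCompact_Icc.bddAbove_image (hK.mono hsub)
  refine eq_zero_of_abs_deriv_le_mul_abs_self_of_eq_zero_right (f' := y') (K := M)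
    (fun t ht => ((hy t (hsub ht)).mono hsub).continuousWithinAt) (fun t ht => ?_) h0
    (fun t ht => ?_) b ⟨hab, le_rfl⟩
  · exact ((hy t (hsub (Ico_subset_Icc_self ht))).mono hsub).mono_of_mem_nhdsWithin
      (Icc_mem_nhdsGE_of_mem ht)
  · have ht' := Ico_subset_Icc_self ht
    exact (hb t (hsub ht')).trans
      (mul_le_mul_of_nonneg_right (hM (mem_image_of_mem K ht')) (norm_nonneg _))

/-- A solution of a linear differential inequality on an interval that vanishes at one point
vanishes identically. -/
theorem eq_zero_of_norm_deriv_le {E : Type*} [NormedAddCommGroup E] [NormedSpace ℝ E]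
    {s : Set ℝ} (hs : s.OrdConnected) {y y' : ℝ → E} {K : ℝ → ℝ} (hK : ContinuousOn K s)
    (hy : ∀ t ∈ s, HasDerivWithinAt y (y' t) s t) (hb : ∀ t ∈ s, ‖y' t‖ ≤ K t * ‖y t‖)
    {t₀ t : ℝ} (ht₀ : t₀ ∈ s) (ht : t ∈ s) (h0 : y t₀ = 0) : y t = 0 := by
  rcases le_total t₀ t with h | h
  · exact eq_zero_of_norm_deriv_le_of_le hs hK hy hb ht₀ ht h h0
  -- Backward in time: apply the forward statement to the reflected curve.
  · have hmaps : MapsTo (fun x : ℝ => -x) (Neg.neg ⁻¹' s) s := fun x hx => hx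
    have key := eq_zero_of_norm_deriv_le_of_le (s := Neg.neg ⁻¹' s) (y := fun x => y (-x))
      (y' := fun x => -y' (-x)) (K := fun x => K (-x)) (a := -t₀) (b := -t)
      ⟨fun x hx z hz w hw => hs.out hz hx ⟨neg_le_neg hw.2, neg_le_neg hw.1⟩⟩
      (hK.comp continuousOn_neg hmaps)
      (fun x hx => by
        exact ((hy (-x) hx).scomp x (hasDerivAt_neg x).hasDerivWithinAt hmaps).congr_deriv
          (neg_one_smul ℝ _))
      (fun x hx => by simpa using hb (-x) hx)
      (by simpa using ht₀) (by simpa using ht) (neg_le_neg h) (by simpa using h0)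
    simpa using key

/-- Solutions of scalar linear differential equations keep their sign. -/
theorem pos_of_deriv_eq_mul {s : Set ℝ} (hs : s.OrdConnected) {y c : ℝ → ℝ}
    (hc : ContinuousOn c s) (hy : ∀ t ∈ s, HasDerivWithinAt y (c t * y t) s t)
    {t₀ t : ℝ} (ht₀ : t₀ ∈ s) (ht : t ∈ s) (h0 : 0 < y t₀) : 0 < y t := by
  by_contra! h
  have hcont : ContinuousOn y s := fun x hx => (hy x hx).continuousWithinAt
  obtain ⟨z, hz, hz0⟩ := hs.isPreconnected.intermediate_value ht ht₀ hcont ⟨h, h0.le⟩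
  -- A zero anywhere would propagate back to `t₀`.
  exact h0.ne' (eq_zero_of_norm_deriv_le hs hc.norm hy (fun x _ => (norm_mul _ _).le) hz ht₀ hz0)

/-! ### Matrix-valued functions of a real variable -/

/-- The entrywise sup norm is not submultiplicative; the factor `n` counts the summands of an entry
of the product. -/
theorem norm_mul_le_card_mul {n : ℕ} (A B : Mat n) : ‖A * B‖ ≤ n * ‖A‖ * ‖B‖ := by
  rw [Matrix.norm_le_iff (by positivity)]
  intro i j
  rw [Matrix.mul_apply]
  have h : ∀ k ∈ Finset.univ, ‖A i k * B k j‖ ≤ ‖A‖ * ‖B‖ := fun k _ => by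
    rw [norm_mul]
    exact mul_le_mul (norm_entry_le_entrywise_sup_norm A) (norm_entry_le_entrywise_sup_norm B)
      (norm_nonneg _) (norm_nonneg _)
  simpa [mul_assoc] using norm_sum_le_of_le _ h

theorem hasDerivWithinAt_matrix {n : ℕ} {F : ℝ → Mat n} {F' : Mat n} {s : Set ℝ} {t : ℝ} :
    HasDerivWithinAt F F' s t ↔ ∀ i j, HasDerivWithinAt (fun x => F x i j) (F' i j) s t :=
  hasDerivWithinAt_pi.trans (forall_congr' fun _ => hasDerivWithinAt_pi)

theorem continuousOn_matrix {n : ℕ} {F : ℝ → Mat n} {s : Set ℝ} :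
    ContinuousOn F s ↔ ∀ i j, ContinuousOn (fun x => F x i j) s :=
  continuousOn_pi.trans (forall_congr' fun _ => continuousOn_pi)

theorem _root_.HasDerivWithinAt.matrix_mul {n : ℕ} {F G : ℝ → Mat n} {F' G' : Mat n} {s : Set ℝ}
    {t : ℝ} (hF : HasDerivWithinAt F F' s t) (hG : HasDerivWithinAt G G' s t) :
    HasDerivWithinAt (fun x => F x * G x) (F' * G t + F t * G') s t := by
  rw [hasDerivWithinAt_matrix] at *
  intro i j
  simp only [Matrix.mul_apply, Matrix.add_apply, ← Finset.sum_add_distrib]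
  exact HasDerivWithinAt.fun_sum fun k _ => (hF i k).mul (hG k j)

theorem _root_.HasDerivWithinAt.matrix_star {n : ℕ} {F : ℝ → Mat n} {F' : Mat n} {s : Set ℝ}
    {t : ℝ} (hF : HasDerivWithinAt F F' s t) :
    HasDerivWithinAt (fun x => star (F x)) (star F') s t := by
  rw [hasDerivWithinAt_matrix] at *
  exact fun i j => (hF j i).star

theorem _root_.ContinuousOn.matrix_mul {n : ℕ} {F G : ℝ → Mat n} {s : Set ℝ}
    (hF : ContinuousOn F s) (hG : ContinuousOn G s) : ContinuousOn (fun x => F x * G x) s :=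
  (continuous_fst.matrix_mul continuous_snd : Continuous fun p : Mat n × Mat n => p.1 * p.2)
    |>.comp_continuousOn (hF.prodMk hG)

theorem continuous_piA {n : ℕ} : Continuous (piA : Mat n → Mat n) := by
  refine continuous_pi fun i => continuous_pi fun j => ?_
  have h : ∀ i j, Continuous fun X : Mat n => X i j := fun i j => continuous_apply_apply i j
  simp only [piA, of_apply]
  split_ifs
  · exact h i j
  · exact (Complex.continuous_conj.comp (h j i)).neg
  · exact continuous_const.mul (Complex.continuous_ofReal.comp (Complex.continuous_im.comp (h i i)))

theorem continuous_piL {n : ℕ} : Continuous (piL : Mat n → Mat n) :=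
  continuous_id.sub continuous_piA

/-! ### The pairing and the Hamiltonian vector -/

theorem pairing_single {n : ℕ} (Z : Mat n) (i j : Fin n) (c : ℂ) :
    pairing Z (Matrix.single i j c) = (Z j i * c).im := by
  simp [pairing, Matrix.trace_mul_single]

theorem eq_of_pairing_left {n : ℕ} {Z W : Mat n} (h : ∀ C, pairing Z C = pairing W C) : Z = W := by
  ext i j
  have h1 := h (Matrix.single j i 1)
  have h2 := h (Matrix.single j i Complex.I)
  rw [pairing_single, pairing_single] at h1 h2
  apply Complex.ext
  · simpa using h2
  · simpa using h1

theorem pairing_comm {n : ℕ} (Z W : Mat n) : pairing Z W = pairing W Z := by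
  rw [pairing, pairing, Matrix.trace_mul_comm]

/-- `⟨Z, ·⟩` as a linear map. -/
noncomputable def pairingLinear {n : ℕ} (Z : Mat n) : Mat n →ₗ[ℝ] ℝ where
  toFun := pairing Z
  map_add' A B := by simp [pairing, mul_add]
  map_smul' c A := by simp [pairing]

theorem grad_pairing {n : ℕ} (Z B : Mat n) : grad (pairing Z) B = Z := by
  refine eq_of_pairing_left fun C => ?_
  rw [pairing_grad]
  have h := (LinearMap.toContinuousLinearMap (pairingLinear Z)).hasFDerivAt (x := B)
  exact congrArg (fun L => L C) h.fderiv

theorem contDiff_pairing {n : ℕ} (Z : Mat n) : ContDiff ℝ ∞ (pairing Z) :=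
  (LinearMap.toContinuousLinearMap (pairingLinear Z)).contDiff

theorem poissonBracket_eq_pairing {n : ℕ} (φ ψ : Mat n → ℝ) (B : Mat n) :
    poissonBracket φ ψ B = pairing (grad ψ B)
      ((1 / 2 : ℝ) • (B * R (grad φ B * B) - R (B * grad φ B) * B)) := by
  have h1 : (R (grad φ B * B) * (grad ψ B * B)).trace =
      (grad ψ B * (B * R (grad φ B * B))).trace := by
    rw [Matrix.trace_mul_comm, mul_assoc]
  have h2 : (R (B * grad φ B) * (B * grad ψ B)).trace =
      (grad ψ B * (R (B * grad φ B) * B)).trace := by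
    rw [← mul_assoc, Matrix.trace_mul_comm]
  simp only [poissonBracket, pairing, h1, h2, mul_smul_comm, mul_sub, Matrix.trace_smul,
    Matrix.trace_sub, Complex.smul_im, Complex.sub_im, smul_eq_mul]

/-- The linear test functions `pairing Z` have constant gradient `Z`, and by nondegeneracy of the
pairing they already determine the vector. -/
theorem IsHamiltonianVector.eq {n : ℕ} {φ : Mat n → ℝ} {B V : Mat n}
    (h : IsHamiltonianVector φ B V) :
    V = (1 / 2 : ℝ) • (B * R (grad φ B * B) - R (B * grad φ B) * B) := by
  refine eq_of_pairing_left fun Z => ?_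
  have h1 := h (pairing Z) (contDiff_pairing Z)
  rw [poissonBracket_eq_pairing, ← pairing_grad, grad_pairing] at h1
  rw [pairing_comm, h1, pairing_comm]

theorem R_eq_sub_piA {n : ℕ} (X : Mat n) : R X = X - (2 : ℝ) • piA X := by
  rw [R, piL, two_smul]
  abel

/-- Writing `R = 1 - 2 piA`, the two copies of `B X B` cancel. -/
theorem IsHamiltonianVector.eq_piA {n : ℕ} {φ : Mat n → ℝ} {B V : Mat n}
    (h : IsHamiltonianVector φ B V) :
    V = piA (B * grad φ B) * B - B * piA (grad φ B * B) := by
  rw [h.eq, R_eq_sub_piA, R_eq_sub_piA, mul_sub, sub_mul, mul_smul_comm, smul_mul_assoc,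
    ← mul_assoc]
  module

/-- Substituting `piL = 1 - piA` on the right produces `B(XB) - (BX)B = 0`. This is what allows the
switch between the two forms of the flow. -/
theorem piA_mul_sub_mul_piA {n : ℕ} (X B : Mat n) :
    piA (B * X) * B - B * piA (X * B) = B * piL (X * B) - piL (B * X) * B := by
  rw [piL, piL, mul_sub, sub_mul, mul_assoc]
  abel

theorem IsHamiltonianCurve.continuousOn {n : ℕ} {U : Set (Mat n)} {φ : Mat n → ℝ} {s : Set ℝ}
    {γ : ℝ → Mat n} (h : IsHamiltonianCurve U φ s γ) : ContinuousOn γ s := fun t ht => by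
  obtain ⟨V, -, hV⟩ := h.deriv t ht
  exact hV.continuousWithinAt

theorem IsHamiltonianCurve.continuousOn_grad {n : ℕ} {U : Set (Mat n)} {φ : Mat n → ℝ} {s : Set ℝ}
    {γ : ℝ → Mat n} (h : IsHamiltonianCurve U φ s γ) : ContinuousOn (fun t => grad φ (γ t)) s := by
  have h1 : ContinuousOn (fun t => fderiv ℝ φ (γ t)) s :=
    (h.smooth.continuousOn_fderiv_of_isOpen h.isOpen (by simp)).comp h.continuousOn h.mem
  rw [continuousOn_matrix]
  intro i j
  have h2 : ∀ C : Mat n, ContinuousOn (fun t => (fderiv ℝ φ (γ t) C : ℂ)) s := fun C =>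
    Complex.continuous_ofReal.comp_continuousOn (h1.clm_apply continuousOn_const)
  exact (h2 _).add (continuousOn_const.mul (h2 _))

theorem IsHamiltonianCurve.hasDerivWithinAt {n : ℕ} {U : Set (Mat n)} {φ : Mat n → ℝ} {s : Set ℝ}
    {γ : ℝ → Mat n} (h : IsHamiltonianCurve U φ s γ) {t : ℝ} (ht : t ∈ s) :
    HasDerivWithinAt γ
      (piA (γ t * grad φ (γ t)) * γ t - γ t * piA (grad φ (γ t) * γ t)) s t := by
  obtain ⟨V, hV, hd⟩ := h.deriv t ht
  rwa [← hV.eq_piA]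

/-! ### Unitarity -/

theorem star_piA {n : ℕ} (X : Mat n) : star (piA X) = -piA X := piA_mem X

/-- In the derivative of `γ*γ` the terms with the left generator cancel, as it is anti-Hermitian;
what remains is the commutator of `P` with `γ*γ`, or equally with `γ*γ - 1`. -/
theorem IsHamiltonianCurve.mem_unitaryGroup {n : ℕ} {U : Set (Mat n)} {φ : Mat n → ℝ} {s : Set ℝ}
    {γ : ℝ → Mat n} (h : IsHamiltonianCurve U φ s γ) {t₀ : ℝ} (ht₀ : t₀ ∈ s)
    (hU : γ t₀ ∈ unitaryGroup (Fin n) ℂ) {t : ℝ} (ht : t ∈ s) :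
    γ t ∈ unitaryGroup (Fin n) ℂ := by
  set P : ℝ → Mat n := fun t => piA (grad φ (γ t) * γ t) with hP
  have hPc : ContinuousOn P s :=
    continuous_piA.comp_continuousOn (h.continuousOn_grad.matrix_mul h.continuousOn)
  set y : ℝ → Mat n := fun t => star (γ t) * γ t - 1 with hy
  have hd : ∀ t ∈ s, HasDerivWithinAt y (P t * y t - y t * P t) s t := fun t ht => by
    have hγ := h.hasDerivWithinAt ht
    refine ((hγ.matrix_star.matrix_mul hγ).sub_const 1).congr_deriv ?_
    simp only [hy, hP, star_sub, star_mul, star_piA]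
    noncomm_ring
  have hb : ∀ t ∈ s, ‖P t * y t - y t * P t‖ ≤ (2 * n * ‖P t‖) * ‖y t‖ := fun t _ => by
    have h1 := norm_mul_le_card_mul (P t) (y t)
    have h2 := norm_mul_le_card_mul (y t) (P t)
    have h3 := norm_sub_le (P t * y t) (y t * P t)
    linarith
  have h0 := eq_zero_of_norm_deriv_le h.ordConnected (continuousOn_const.mul hPc.norm) hd hb ht₀ ht
    (sub_eq_zero.2 (mem_unitaryGroup_iff'.1 hU))
  exact mem_unitaryGroup_iff'.2 (sub_eq_zero.1 h0)

/-! ### Flows of lower triangular matrices -/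

/-- If `F' = F P - Q F` with lower triangular `P` and `Q`, then zeros of `F` in a set of positions
that is closed under moving up and to the right are preserved. -/
theorem eq_zero_of_lowerTri_deriv {n : ℕ} {s : Set ℝ} (hs : s.OrdConnected) {F P Q : ℝ → Mat n}
    (hP : ContinuousOn P s) (hQ : ContinuousOn Q s) (hPL : ∀ t, P t ∈ lowerTri n)
    (hQL : ∀ t, Q t ∈ lowerTri n)
    (hF : ∀ t ∈ s, HasDerivWithinAt F (F t * P t - Q t * F t) s t) {S : Fin n → Fin n → Prop}
    (hS : ∀ i i' j j', S i j → i' ≤ i → j ≤ j' → S i' j') {t₀ : ℝ} (ht₀ : t₀ ∈ s)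
    (h0 : ∀ i j, S i j → F t₀ i j = 0) {t : ℝ} (ht : t ∈ s) {i j : Fin n} (hij : S i j) :
    F t i j = 0 := by
  classical
  -- Truncation to the positions in `S`. By triangularity an entry of the derivative involves only
  -- entries of `F` above it or to its right, so the truncated matrix satisfies a closed linear
  -- equation.
  let τ : Mat n → Mat n := fun X => Matrix.of fun i j => if S i j then X i j else 0
  have hτ : ∀ t, τ (F t * P t - Q t * F t) = τ (τ (F t) * P t - Q t * τ (F t)) := fun t => by
    ext i j
    by_cases hij : S i j
    · simp only [τ, of_apply, if_pos hij, Matrix.sub_apply, Matrix.mul_apply]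
      congr 1
      · refine Finset.sum_congr rfl fun k _ => ?_
        rcases lt_or_ge k j with hk | hk
        · rw [(hPL t).1 k j hk, mul_zero, mul_zero]
        · rw [if_pos (hS _ _ _ _ hij le_rfl hk)]
      · refine Finset.sum_congr rfl fun k _ => ?_
        rcases lt_or_ge i k with hk | hk
        · rw [(hQL t).1 i k hk, zero_mul, zero_mul]
        · rw [if_pos (hS _ _ _ _ hij hk le_rfl)]
    · simp [τ, hij]
  have hτn : ∀ X, ‖τ X‖ ≤ ‖X‖ := fun X => by
    rw [Matrix.norm_le_iff (norm_nonneg _)]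
    intro i j
    simp only [τ, of_apply]
    split_ifs
    · exact norm_entry_le_entrywise_sup_norm X
    · simp
  have hd : ∀ t ∈ s, HasDerivWithinAt (fun t => τ (F t)) (τ (F t * P t - Q t * F t)) s t :=
    fun t ht => by
      rw [hasDerivWithinAt_matrix]
      intro i j
      by_cases hij : S i j
      · simpa [τ, hij] using hasDerivWithinAt_matrix.1 (hF t ht) i j
      · simpa [τ, hij] using hasDerivWithinAt_const t s (0 : ℂ)
  have hb : ∀ t ∈ s, ‖τ (F t * P t - Q t * F t)‖ ≤ (n * ‖P t‖ + n * ‖Q t‖) * ‖τ (F t)‖ :=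
    fun t _ => by
      rw [hτ]
      refine (hτn _).trans ((norm_sub_le _ _).trans ?_)
      have h1 := norm_mul_le_card_mul (τ (F t)) (P t)
      have h2 := norm_mul_le_card_mul (Q t) (τ (F t))
      linarith
  have hz : τ (F t₀) = 0 := by
    ext i j
    by_cases hij : S i j
    · simp [τ, hij, h0 i j hij]
    · simp [τ, hij]
  have h := eq_zero_of_norm_deriv_le hs
    ((continuousOn_const.mul hP.norm).add (continuousOn_const.mul hQ.norm)) hd hb ht₀ ht hz
  simpa [τ, hij] using congrFun (congrFun h i) j

/-- If `F' = F P - Q F` with lower triangular `P` and `Q` with real diagonal, then an entry of `F`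
above and to the right of which `F` vanishes remains positive. -/
theorem pos_of_lowerTri_deriv {n : ℕ} {s : Set ℝ} (hs : s.OrdConnected) {F P Q : ℝ → Mat n}
    (hP : ContinuousOn P s) (hQ : ContinuousOn Q s) (hPL : ∀ t, P t ∈ lowerTri n)
    (hQL : ∀ t, Q t ∈ lowerTri n)
    (hF : ∀ t ∈ s, HasDerivWithinAt F (F t * P t - Q t * F t) s t) {i j : Fin n}
    (hright : ∀ t ∈ s, ∀ k, j < k → F t i k = 0) (hup : ∀ t ∈ s, ∀ k, k < i → F t k j = 0)
    {t₀ : ℝ} (ht₀ : t₀ ∈ s) (h0 : 0 < (F t₀ i j).re ∧ (F t₀ i j).im = 0) {t : ℝ} (ht : t ∈ s) :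
    0 < (F t i j).re ∧ (F t i j).im = 0 := by
  set c : ℝ → ℝ := fun t => (P t j j).re - (Q t i i).re with hc
  have hcc : ContinuousOn c s :=
    (Complex.continuous_re.comp_continuousOn (continuousOn_matrix.1 hP j j)).sub
      (Complex.continuous_re.comp_continuousOn (continuousOn_matrix.1 hQ i i))
  have hd : ∀ t ∈ s, HasDerivWithinAt (fun t => F t i j) ((c t : ℂ) * F t i j) s t :=
    fun t ht => by
      refine (hasDerivWithinAt_matrix.1 (hF t ht) i j).congr_deriv ?_
      have hPj : (P t j j) = ((P t j j).re : ℂ) := by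
        apply Complex.ext <;> simp [(hPL t).2 j]
      have hQi : (Q t i i) = ((Q t i i).re : ℂ) := by
        apply Complex.ext <;> simp [(hQL t).2 i]
      rw [Matrix.sub_apply, Matrix.mul_apply, Matrix.mul_apply,
        Finset.sum_eq_single j (fun k _ hk => ?_) (by simp),
        Finset.sum_eq_single i (fun k _ hk => ?_) (by simp), hPj, hQi]
      · simp only [hc]
        push_cast
        ring
      · rcases lt_or_gt_of_ne hk with hk | hk
        · rw [hup t ht k hk, mul_zero]
        · rw [(hQL t).1 i k hk, zero_mul]
      · rcases lt_or_gt_of_ne hk with hk | hk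
        · rw [(hPL t).1 k j hk, mul_zero]
        · rw [hright t ht k hk, zero_mul]
  have hre : ∀ t ∈ s, HasDerivWithinAt (fun t => (F t i j).re) (c t * (F t i j).re) s t :=
    fun t ht => by
      exact (Complex.reCLM.hasFDerivAt.comp_hasDerivWithinAt t (hd t ht)).congr_deriv (by simp)
  have him : ∀ t ∈ s, HasDerivWithinAt (fun t => (F t i j).im) (c t * (F t i j).im) s t :=
    fun t ht => by
      exact (Complex.imCLM.hasFDerivAt.comp_hasDerivWithinAt t (hd t ht)).congr_deriv (by simp)
  exact ⟨pos_of_deriv_eq_mul hs hcc hre ht₀ ht h0.1,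
    eq_zero_of_norm_deriv_le hs hcc.norm him (fun x _ => (norm_mul _ _).le) ht₀ ht h0.2⟩

/-- Hamiltonian flows on unitary matrices preserve CMV shape. -/
theorem IsHamiltonianCurve.hasCMVShape {n : ℕ} {U : Set (Mat n)} {φ : Mat n → ℝ} {s : Set ℝ}
    {γ : ℝ → Mat n} (h : IsHamiltonianCurve U φ s γ) {t₀ : ℝ} (ht₀ : t₀ ∈ s)
    (hU : γ t₀ ∈ unitaryGroup (Fin n) ℂ) (hS : HasCMVShape (γ t₀)) {t : ℝ} (ht : t ∈ s) :
    HasCMVShape (γ t) := by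
  set P : ℝ → Mat n := fun t => piL (grad φ (γ t) * γ t) with hPdef
  set Q : ℝ → Mat n := fun t => piL (γ t * grad φ (γ t)) with hQdef
  have hs := h.ordConnected
  have hP : ContinuousOn P s :=
    continuous_piL.comp_continuousOn (h.continuousOn_grad.matrix_mul h.continuousOn)
  have hQ : ContinuousOn Q s :=
    continuous_piL.comp_continuousOn (h.continuousOn.matrix_mul h.continuousOn_grad)
  have hPL : ∀ t, P t ∈ lowerTri n := fun t => piL_mem _
  have hQL : ∀ t, Q t ∈ lowerTri n := fun t => piL_mem _
  have hd : ∀ t ∈ s, HasDerivWithinAt γ (γ t * P t - Q t * γ t) s t := fun t ht =>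
    (h.hasDerivWithinAt ht).congr_deriv (piA_mul_sub_mul_piA _ _)
  -- Starring the anti-Hermitian form and multiplying the identity of the two forms by `γ*` on both
  -- sides gives the triangular equation for `γ*`, with `P` and `Q` exchanged. No inverse has to be
  -- differentiated.
  have hds : ∀ t ∈ s, HasDerivWithinAt (fun t => star (γ t))
      (star (γ t) * Q t - P t * star (γ t)) s t := fun t ht => by
    have hu := h.mem_unitaryGroup ht₀ hU ht
    have e1 := mem_unitaryGroup_iff.1 hu
    have e2 := mem_unitaryGroup_iff'.1 hu
    refine (h.hasDerivWithinAt ht).matrix_star.congr_deriv ?_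
    have e3 := congrArg (fun X => star (γ t) * X * star (γ t))
      (piA_mul_sub_mul_piA (grad φ (γ t)) (γ t))
    simp only [mul_sub, sub_mul, mul_assoc, e1, mul_one] at e3
    simp only [← mul_assoc, e2, one_mul] at e3
    simp only [star_sub, star_mul, star_piA, hPdef, hQdef, mul_neg, neg_mul]
    rw [neg_sub_neg, ← neg_sub, e3, neg_sub]
  have hup : ∀ t ∈ s, ∀ i j : Fin n, 2 * ((i : ℕ) / 2) + 2 < j → γ t i j = 0 :=
    fun t ht i j hij => eq_zero_of_lowerTri_deriv hs hP hQ hPL hQL hd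
      (S := fun i j => 2 * ((i : ℕ) / 2) + 2 < j)
      (fun i i' j j' h1 (h2 : (i' : ℕ) ≤ i) (h3 : (j : ℕ) ≤ j') => by omega)
      ht₀ (fun i j hij => hS.1 i j (by omega)) ht hij
  have hlow : ∀ t ∈ s, ∀ i j : Fin n, (j : ℕ) + 1 < 2 * ((i : ℕ) / 2) → γ t i j = 0 :=
    fun t ht i j hij => by
      have := eq_zero_of_lowerTri_deriv hs hQ hP hQL hPL hds
        (S := fun j i => (j : ℕ) + 1 < 2 * ((i : ℕ) / 2))
        (fun i i' j j' h1 (h2 : (i' : ℕ) ≤ i) (h3 : (j : ℕ) ≤ j') => by omega)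
        ht₀ (fun j i hij => by
          rw [Matrix.star_apply, hS.1 i j (by omega), star_zero]) ht hij
      simpa [Matrix.star_apply] using this
  -- The entries exposed at the lower left of `γ` are upper right corners of `γ*`.
  have hlower : ∀ i j : Fin n, (∀ k : Fin n, i < k → (j : ℕ) + 1 < 2 * ((k : ℕ) / 2)) →
      (∀ k : Fin n, k < j → (k : ℕ) + 1 < 2 * ((i : ℕ) / 2)) → IsExposed i j →
      0 < (γ t i j).re ∧ (γ t i j).im = 0 := fun i j h1 h2 hij => by
    have h0 := hS.2 i j hij
    have := pos_of_lowerTri_deriv hs hQ hP hQL hPL hds (i := j) (j := i)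
      (fun t ht k hk => by rw [Matrix.star_apply, hlow t ht _ _ (h1 k hk), star_zero])
      (fun t ht k hk => by rw [Matrix.star_apply, hlow t ht _ _ (h2 k hk), star_zero])
      ht₀ (by simpa [Matrix.star_apply] using h0) ht
    simpa [Matrix.star_apply] using this
  refine ⟨fun i j hij => ?_, fun i j hij => ?_⟩
  · by_cases h1 : 2 * ((i : ℕ) / 2) + 2 < j
    · exact hup t ht i j h1
    · exact hlow t ht i j (by omega)
  · rcases hij with h1 | h1 | h1
    · exact hlower i j (fun k (hk : (i : ℕ) < k) => by omega)
        (fun k (hk : (k : ℕ) < j) => by omega) (Or.inl h1)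
    · exact pos_of_lowerTri_deriv hs hP hQ hPL hQL hd
        (fun t ht k (hk : (j : ℕ) < k) => hup t ht _ _ (by omega))
        (fun t ht k (hk : (k : ℕ) < i) => hup t ht _ _ (by omega)) ht₀
        (hS.2 i j (Or.inr (Or.inl h1))) ht
    · exact hlower i j (fun k (hk : (i : ℕ) < k) => by omega)
        (fun k (hk : (k : ℕ) < j) => by omega) (Or.inr (Or.inr h1))

/-! ### The determinant -/

theorem differentiable_det {n : ℕ} : Differentiable ℝ (fun M : Mat n => M.det) := by
  simp only [Matrix.det_apply']
  refine Differentiable.fun_sum fun σ _ => ?_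
  refine Differentiable.const_mul (fun B => ?_) _
  have h : ∀ i, DifferentiableAt ℝ (fun M : Mat n => M (σ i) i) B := fun i =>
    differentiable_pi.1 (differentiable_pi.1 differentiable_id (σ i)) i B
  exact (HasFDerivAt.finsetProd fun i _ => (h i).hasFDerivAt).differentiableAt

theorem hasDerivAt_det_one_add_smul {n : ℕ} (C : Mat n) :
    HasDerivAt (fun r : ℝ => (1 + r • C).det) C.trace 0 := by
  -- The expansion of `det (1 + r C)` to first order, with a polynomial remainder divisible by `r ^
  -- 2`.
  have h : ∀ r : ℝ, (1 + r • C).det = 1 + C.trace * r +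
      ((det (1 + (Polynomial.X : Polynomial ℂ) • C.map Polynomial.C)).divX.divX.eval (r : ℂ)) *
        (r : ℂ) ^ 2 := fun r => by
    rw [← Matrix.det_one_add_smul]
    rfl
  have hr : HasDerivAt (fun r : ℝ => (r : ℂ)) 1 0 := Complex.ofRealCLM.hasDerivAt
  have hp := ((Polynomial.hasDerivAt
    (det (1 + (Polynomial.X : Polynomial ℂ) • C.map Polynomial.C)).divX.divX ((0 : ℝ) : ℂ))).comp
      (0 : ℝ) hr
  simp only [h]
  exact (((hr.const_mul C.trace).const_add 1).add (hp.mul (hr.pow 2))).congr_deriv (by simp)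

/-- In the direction `B * C` the determinant factors as `det B · det (1 + r C)`, so singular `B`
need no separate treatment. -/
theorem fderiv_det_mul {n : ℕ} (B C : Mat n) :
    fderiv ℝ (fun M : Mat n => M.det) B (B * C) = B.det * C.trace := by
  have h1 : HasDerivAt (fun r : ℝ => (B + r • (B * C)).det)
      (fderiv ℝ (fun M : Mat n => M.det) B (B * C)) 0 :=
    (differentiable_det B).hasFDerivAt.hasLineDerivAt (B * C)
  refine h1.unique (((hasDerivAt_det_one_add_smul C).const_mul B.det).congr_of_eventuallyEq ?_)
  filter_upwards with r
  rw [← Matrix.det_mul, mul_add, mul_one, mul_smul_comm]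

theorem fderiv_det_mul' {n : ℕ} (B C : Mat n) :
    fderiv ℝ (fun M : Mat n => M.det) B (C * B) = B.det * C.trace := by
  have h1 : HasDerivAt (fun r : ℝ => (B + r • (C * B)).det)
      (fderiv ℝ (fun M : Mat n => M.det) B (C * B)) 0 :=
    (differentiable_det B).hasFDerivAt.hasLineDerivAt (C * B)
  refine h1.unique (((hasDerivAt_det_one_add_smul C).const_mul B.det).congr_of_eventuallyEq ?_)
  filter_upwards with r
  rw [mul_comm B.det, ← Matrix.det_mul, add_mul, one_mul, smul_mul_assoc]

theorem trace_piA {n : ℕ} (X : Mat n) : (piA X).trace = Complex.I * (X.trace.im : ℂ) := by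
  simp [Matrix.trace, piA, Finset.mul_sum]

/-- The determinant is constant along Hamiltonian curves. -/
theorem IsHamiltonianCurve.det_eq {n : ℕ} {U : Set (Mat n)} {φ : Mat n → ℝ} {s : Set ℝ}
    {γ : ℝ → Mat n} (h : IsHamiltonianCurve U φ s γ) {t₀ t : ℝ} (ht₀ : t₀ ∈ s) (ht : t ∈ s) :
    (γ t).det = (γ t₀).det := by
  have hd : ∀ t ∈ s, HasDerivWithinAt (fun t => (γ t).det - (γ t₀).det) 0 s t := fun t ht => by
    -- Both traces equal `i Im tr (γ X)` by cyclicity.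
    have h0 : fderiv ℝ (fun M : Mat n => M.det) (γ t)
        (piA (γ t * grad φ (γ t)) * γ t - γ t * piA (grad φ (γ t) * γ t)) = 0 := by
      rw [map_sub, fderiv_det_mul, fderiv_det_mul', trace_piA, trace_piA, Matrix.trace_mul_comm,
        sub_self]
    exact (((differentiable_det (γ t)).hasFDerivAt.comp_hasDerivWithinAt t
      (h.hasDerivWithinAt ht)).sub_const _).congr_deriv h0
  exact sub_eq_zero.1 (eq_zero_of_norm_deriv_le h.ordConnected (K := fun _ => 0)
    continuousOn_const hd (fun _ _ => by simp) ht₀ ht (sub_self _))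

theorem R_smul_one {n : ℕ} (c : ℂ) : R (c • (1 : Mat n)) = (starRingEnd ℂ) c • (1 : Mat n) := by
  ext i j
  rcases lt_trichotomy i j with h | h | h
  · simp [R, piL, piA, h, h.ne]
  · subst h
    apply Complex.ext
    · simp [R, piL, piA]
    · simp [R, piL, piA]
  · simp [R, piL, piA, h, h.ne, h.ne', h.not_gt]

/-- The bracket with a function of the determinant vanishes. -/
theorem poissonBracket_det {n : ℕ} (B : Mat n) (g : ℂ → ℝ) (ψ : Mat n → ℝ)
    (hg : DifferentiableAt ℝ g B.det) : poissonBracket (fun M => g M.det) ψ B = 0 := by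
  set L := fderiv ℝ g B.det with hL
  have hfd : ∀ C, fderiv ℝ (fun M : Mat n => g M.det) B C =
      L (fderiv ℝ (fun M : Mat n => M.det) B C) := fun C =>
    congrArg (fun T => T C) (hg.hasFDerivAt.comp B (differentiable_det B).hasFDerivAt).fderiv
  -- The number that represents the real linear functional `L` as `z ↦ Im (w z)`, the scalar case of
  -- the gradient.
  set w : ℂ := L Complex.I + Complex.I * L 1 with hw
  have hLw : ∀ z, L z = (w * z).im := fun z => by
    have hz : z = z.re • (1 : ℂ) + z.im • Complex.I := by apply Complex.ext <;> simp
    conv_lhs => rw [hz, map_add, map_smul, map_smul]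
    simp [hw, Complex.mul_im]
    ring
  set X := grad (fun M : Mat n => g M.det) B with hX
  have h1 : X * B = (w * B.det) • (1 : Mat n) := eq_of_pairing_left fun C => by
    have e : pairing (X * B) C = pairing X (B * C) := by rw [pairing, pairing, mul_assoc]
    rw [e, hX, pairing_grad, hfd, fderiv_det_mul, hLw]
    simp [pairing, mul_assoc]
  have h2 : B * X = (w * B.det) • (1 : Mat n) := eq_of_pairing_left fun C => by
    have e : pairing (B * X) C = pairing X (C * B) := by
      rw [pairing, pairing, mul_assoc, Matrix.trace_mul_comm, mul_assoc]
    rw [e, hX, pairing_grad, hfd, fderiv_det_mul', hLw]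
    simp [pairing, mul_assoc]
  -- With the same scalar on both sides, the bracket reduces to the difference of `tr (YB)` and `tr
  -- (BY)`, up to that scalar's conjugate.
  rw [poissonBracket, ← hX, h1, h2, R_smul_one]
  simp [pairing, Matrix.trace_mul_comm B]

/-! ### Symplectic leaves -/

theorem IsCMV.of_mem_symplecticLeaf {n : ℕ} (hn : 1 ≤ n) {C : Mat n} (hC : IsCMV C) {B : Mat n}
    (hB : B ∈ symplecticLeaf C) : IsCMV B ∧ B.det = C.det := by
  change Relation.ReflTransGen HamiltonianStep C B at hB
  induction hB with
  | refl => exact ⟨hC, rfl⟩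
  | tail _ hstep ih =>
    obtain ⟨U, φ, T, γ, hT, hγ, rfl, rfl⟩ := hstep
    have m0 : (0 : ℝ) ∈ Icc 0 T := ⟨le_rfl, hT⟩
    have mT : T ∈ Icc 0 T := ⟨hT, le_rfl⟩
    have hu := ih.1.mem_unitaryGroup
    exact ⟨(hγ.hasCMVShape m0 hu ih.1.hasCMVShape mT).isCMV hn (hγ.mem_unitaryGroup m0 hu mT),
      (hγ.det_eq m0 mT).trans ih.2⟩

end CMV

theorem propositionP (n : ℕ) (hn : 1 ≤ n) :
    -- the leaf through a CMV matrix consists of CMV matrices of the same determinant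
    (∀ C : CMV.Mat n, CMV.IsCMV C →
      ∀ B ∈ CMV.symplecticLeaf C, CMV.IsCMV B ∧ B.det = C.det) ∧
    -- the determinant is a Casimir: real functions of it Poisson commute with everything
    (∀ (B : CMV.Mat n) (g : ℂ → ℝ) (ψ : CMV.Mat n → ℝ),
      DifferentiableAt ℝ g B.det → DifferentiableAt ℝ ψ B →
        CMV.poissonBracket (fun M => g M.det) ψ B = 0) ∧
    -- Hamiltonian flows preserve unitarity
    (∀ (U : Set (CMV.Mat n)) (φ : CMV.Mat n → ℝ) (s : Set ℝ) (γ : ℝ → CMV.Mat n),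
      CMV.IsHamiltonianCurve U φ s γ → ∀ t₀ ∈ s, γ t₀ ∈ Matrix.unitaryGroup (Fin n) ℂ →
        ∀ t ∈ s, γ t ∈ Matrix.unitaryGroup (Fin n) ℂ) ∧
    -- Hamiltonian flows through CMV matrices stay in CMV shape, with positive exposed entries
    (∀ (U : Set (CMV.Mat n)) (φ : CMV.Mat n → ℝ) (s : Set ℝ) (γ : ℝ → CMV.Mat n),
      CMV.IsHamiltonianCurve U φ s γ → ∀ t₀ ∈ s, CMV.IsCMV (γ t₀) →
        ∀ t ∈ s, CMV.HasCMVShape (γ t)) := by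

  exact ⟨fun C hC B hB => hC.of_mem_symplecticLeaf hn hB,
    fun B g ψ hg _ => CMV.poissonBracket_det B g ψ hg,
    fun U φ s γ h t₀ ht₀ hU t ht => h.mem_unitaryGroup ht₀ hU ht,
    fun U φ s γ h t₀ ht₀ hC t ht => h.hasCMVShape ht₀ hC.mem_unitaryGroup hC.hasCMVShape ht⟩
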